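/- Let $(\mathcal X,\mathcal A,P,\mathcal R,\gamma)$ be a Markov decision process with finite state space $\mathcal X$, finite action space $\mathcal A$, real-valued reward $\mathcal R$ and discount factor $\gamma\in(0,1)$. Fix a deterministic policy $\pi$; let $P(x,y)$ and $r(x)=\mathcal R(x,\pi(x))$ be the transition probabilities and the reward of the induced Markov chain, and let $V(x)=\mathbb E\big[\sum_{t\ge 0}\gamma^t r(X_t)\,\big|\,X_0=x\big]$ be its value function. Let $\mu$ be a stationary distribution of the chain, and write $\|f\|_\mu=\big(\sum_x f(x)^2\mu(x)\big)^{1/2}$. For a linear space $\mathcal S$ of functions on $\mathcal X$, let $\Pi_{\mathcal S}$ be the orthogonal projection onto $\mathcal S$ for the $\mu$-weighted inner product. (If $\|\cdot\|_\mu$ is only a seminorm on $\mathcal S$, $\Pi_{\mathcal S}f$ is a fixed choice among the orthogonal projections of $f$, depending only on $\mathcal S$ and on the set of these projections.) Let $d<D$ be integers, let $\phi:\mathcal X\to\mathbb R^D$ have linearly independent coordinate functions $\phi_1,\dots,\phi_D$, and let $\mathcal F=\{f_\alpha=\phi(\cdot)^{T}\alpha:\alpha\in\mathbb R^D\}$ and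 $m(f_\alpha)=\|\alpha\|_2\,\sup_x\|\phi(x)\|_2$. Let $H$ be a random $d\times D$ matrix with i.i.d. $\mathcal N(0,1/d)$ entries, let $\psi=H\phi$, and let $\mathcal G=\{\psi(\cdot)^{T}\beta:\beta\in\mathbb R^d\}$. With $TW=r+\gamma PW$, put $T^\lambda=(1-\lambda)\sum_{i\ge 0}\lambda^iT^{i+1}$ for $\lambda\in[0,1)$, and let $T^{1}W=V$ for all $W$ (the limit as $\lambda\uparrow 1$). Suppose that the chain $(X_t)_{t\ge1}$ with transition probabilities $P$ and $X_1\sim\mu$ is a stationary exponentially $\beta$-mixing sequence: for some constants $\beta_0,\beta_1,\kappa>0$, its $\beta$-mixing coefficients satisfy $\beta(m)\le\beta_0\exp(-\beta_1m^\kappa)$ for all $m\ge 1$. Let $\delta\in(0,1)$, $\lambda\in[0,1]$, and let $n\ge1$ be an integer. If $d\ge 15\log(8n/\delta)$, then with probability at least $1-\delta$ with respect to $H$, the projected equation $W=\Pi_{\mathcal G}T^\lambda W$ has a unique solution $W=V_{\mathrm{LSTD}(\lambda)\text{-RP}}$, and $$\|V-V_{\mathrm{LSTD}(\lambda)\text{-RP}}\|_\mu\le\frac{1-\lambda\gamma}{1-\gamma}\Big[\|V-\Pi_{\mathcal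 F}V\|_\mu+\sqrt{\tfrac8d\log\tfrac{8n}{\delta}}\;\Big(1+\frac{2\sqrt{\Upsilon(n,\delta/2)}}{\sqrt n}\Big)\,m(\Pi_{\mathcal F}V)\Big],$$ where $\Upsilon(n,\delta)=\big(\log\frac{4+n\beta_0}{\delta}\big)^{1+1/\kappa}\beta_1^{-1/\kappa}$. -/

import Mathlib

open MeasureTheory ProbabilityTheory
open scoped ENNReal NNReal

namespace LSTDRP

noncomputable section

/-! ### Markov decision processes, Markov chains and value functions -/

/-- A discounted Markov decision process on finite state and action spaces `S`, `A`. -/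
structure MDP (S A : Type*) where
  /-- `trans x a` is the law of the next state when action `a` is taken in state `x`. -/
  trans : S → A → PMF S
  /-- the reward function -/
  reward : S → A → ℝ
  /-- the discount factor -/
  γ : ℝ
  γ_pos : 0 < γ
  γ_lt_one : γ < 1

/-- The transition probabilities of the Markov chain induced by a deterministic policy. -/
def MDP.chain {S A : Type*} (M : MDP S A) (π : S → A) (x : S) : PMF S := M.trans x (π x)

/-- The reward function of the Markov chain induced by a deterministic policy. -/
def MDP.chainReward {S A : Type*} (M : MDP S A) (π : S → A) (x : S) : ℝ := M.reward x (π x)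

/-- The transition kernel `P`, read as a kernel from the history up to time `n` to the state at
time `n + 1`: only the last state of the history matters. -/
def stepKernel {S : Type*} [Finite S] [MeasurableSpace S] [DiscreteMeasurableSpace S]
    (P : S → PMF S) (n : ℕ) : Kernel ((i : Finset.Iic n) → (fun _ : ℕ => S) i) S :=
  Kernel.comap (Kernel.ofFunOfCountable fun x => (P x).toMeasure)
    (fun h : ((i : Finset.Iic n) → (fun _ : ℕ => S) i) => (h ⟨n, Finset.mem_Iic.2 le_rfl⟩ : S))
    (measurable_pi_apply _)

instance {S : Type*} [Finite S] [MeasurableSpace S] [DiscreteMeasurableSpace S]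
    (P : S → PMF S) (n : ℕ) : IsMarkovKernel (stepKernel P n) :=
  ⟨fun h => PMF.toMeasure.isProbabilityMeasure (P (h ⟨n, Finset.mem_Iic.2 le_rfl⟩))⟩

/-- The law on trajectories `ℕ → S` of the Markov chain with initial law `ν` and transition
probabilities `P`. -/
def chainLaw {S : Type*} [Finite S] [MeasurableSpace S] [DiscreteMeasurableSpace S]
    (P : S → PMF S) (ν : PMF S) : Measure (ℕ → S) :=
  Kernel.trajMeasure (X := fun _ => S) ν.toMeasure (stepKernel P)

/-- The value function of a policy: `V x = 𝔼[∑ₜ γ ^ t * r (X t) | X 0 = x]`. -/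
def MDP.value {S A : Type*} [Finite S] [MeasurableSpace S] [DiscreteMeasurableSpace S]
    (M : MDP S A) (π : S → A) (x : S) : ℝ :=
  ∫ ω, ∑' t : ℕ, M.γ ^ t * M.chainReward π (ω t) ∂(chainLaw (M.chain π) (PMF.pure x))

/-- The Bellman operator `W ↦ r + γ P W` of a policy. -/
def MDP.bellman {S A : Type*} [Fintype S] (M : MDP S A) (π : S → A) (W : S → ℝ) : S → ℝ :=
  fun x => M.chainReward π x + M.γ * ∑ y, (M.chain π x y).toReal * W y

/-- The multi-step Bellman operator `T^l = (1 - l) ∑ᵢ l ^ i T ^ (i + 1)` for `0 ≤ l < 1`. For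
`l = 1` the expression is read, as usual, as the limit `l ↑ 1` (which is also `limᵢ T ^ i W`),
i.e. the constant operator with value `V`. -/
def MDP.bellmanTrace {S A : Type*} [Fintype S] [MeasurableSpace S] [DiscreteMeasurableSpace S]
    (M : MDP S A) (π : S → A) (l : ℝ) (W : S → ℝ) : S → ℝ :=
  if l = 1 then M.value π
  else fun x => (1 - l) * ∑' i : ℕ, l ^ i * ((M.bellman π)^[i + 1] W) x

/-! ### The weighted norm and orthogonal projections -/

/-- The `μ`-weighted inner product of functions on a finite state space. -/
def wInner {S : Type*} [Fintype S] (μ : PMF S) (f g : S → ℝ) : ℝ :=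
  ∑ x, (μ x).toReal * (f x * g x)

/-- The `μ`-weighted `L²` norm. -/
def wNorm {S : Type*} [Fintype S] (μ : PMF S) (f : S → ℝ) : ℝ :=
  √(∑ x, f x ^ 2 * (μ x).toReal)

/-- `g` is an orthogonal projection of `f` on `F` for the `μ`-weighted inner product. -/
def IsOrthProj {S : Type*} [Fintype S] (μ : PMF S) (F : Submodule ℝ (S → ℝ)) (f g : S → ℝ) :
    Prop :=
  g ∈ F ∧ ∀ h ∈ F, wInner μ (f - g) h = 0

/-- The orthogonal projection of `f` on `F`. It always exists (`isOrthProj_orthProj`) and is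
unique as soon as `‖·‖_μ` is a norm on `F` (`IsOrthProj.eq_of_norm`), in particular when `μ`
charges every state; in general two choices differ by a function that vanishes `μ`-a.e. -/
def orthProj {S : Type*} [Fintype S] (μ : PMF S) (F : Submodule ℝ (S → ℝ)) (f : S → ℝ) : S → ℝ :=
  Classical.epsilon (IsOrthProj μ F f)

theorem exists_isOrthProj {S : Type*} [Fintype S] (μ : PMF S) (F : Submodule ℝ (S → ℝ))
    (f : S → ℝ) : ∃ g, IsOrthProj μ F f g := by
  let e : (S → ℝ) →ₗ[ℝ] EuclideanSpace ℝ S :=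
    { toFun := fun u => WithLp.toLp 2 fun x => √(μ x).toReal * u x
      map_add' := fun u v => by ext x; simp [mul_add]
      map_smul' := fun c u => by ext x; simp; ring }
  have he : ∀ u v, inner ℝ (e u) (e v) = wInner μ u v := fun u v => by
    simp only [wInner, PiLp.inner_apply, e, LinearMap.coe_mk, AddHom.coe_mk]
    refine Finset.sum_congr rfl fun x _ => ?_
    have := Real.mul_self_sqrt (ENNReal.toReal_nonneg (a := μ x))
    simp only [RCLike.inner_apply, conj_trivial]
    linear_combination (u x * v x) * this
  obtain ⟨g, hg, hge⟩ := (Submodule.mem_map).1 ((F.map e).starProjection_apply_mem (e f))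
  refine ⟨g, hg, fun h hh => ?_⟩
  rw [← he, map_sub, hge]
  exact Submodule.starProjection_inner_eq_zero (e f) (e h) (Submodule.mem_map_of_mem hh)

theorem isOrthProj_orthProj {S : Type*} [Fintype S] (μ : PMF S) (F : Submodule ℝ (S → ℝ))
    (f : S → ℝ) : IsOrthProj μ F f (orthProj μ F f) :=
  Classical.epsilon_spec (exists_isOrthProj μ F f)

theorem IsOrthProj.eq_of_norm {S : Type*} [Fintype S] {μ : PMF S} {F : Submodule ℝ (S → ℝ)}
    (hF : ∀ g ∈ F, wInner μ g g = 0 → g = 0) {f g g' : S → ℝ} (hg : IsOrthProj μ F f g)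
    (hg' : IsOrthProj μ F f g') : g = g' := by
  have hd := F.sub_mem hg.1 hg'.1
  refine sub_eq_zero.1 (hF _ hd ?_)
  have h1 := hg.2 _ hd
  have h2 := hg'.2 _ hd
  simp only [wInner, Pi.sub_apply] at h1 h2 ⊢
  rw [← sub_eq_zero.2 (h2.trans h1.symm), ← Finset.sum_sub_distrib]
  exact Finset.sum_congr rfl fun x _ => by ring

/-! ### Linear function spaces and random projections -/

/-- `α ↦ f_α`, where `f_α x = φ(x)ᵀ α`, for a feature map `φ : S → ℝᵏ`. -/
def linComb {S : Type*} {k : ℕ} (φ : S → EuclideanSpace ℝ (Fin k)) :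
    EuclideanSpace ℝ (Fin k) →ₗ[ℝ] (S → ℝ) where
  toFun α := fun x => ∑ i, φ x i * α i
  map_add' α β := by ext x; simp [mul_add, Finset.sum_add_distrib]
  map_smul' c α := by
    ext x
    simp only [PiLp.smul_apply, smul_eq_mul, RingHom.id_apply, Pi.smul_apply, Finset.mul_sum]
    exact Finset.sum_congr rfl fun i _ => by ring

/-- The linear function space `{f_α | α ∈ ℝᵏ}` spanned by the features. -/
def featSpace {S : Type*} {k : ℕ} (φ : S → EuclideanSpace ℝ (Fin k)) : Submodule ℝ (S → ℝ) :=
  LinearMap.range (linComb φ)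

/-- `m(f_α) = ‖α‖₂ supₓ ‖φ(x)‖₂` for `f_α` in the function space of `φ`. The coefficient vector
`α` is unique when the features are linearly independent. -/
def mFactor {S : Type*} {k : ℕ} (φ : S → EuclideanSpace ℝ (Fin k)) (f : S → ℝ) : ℝ :=
  ‖Classical.epsilon fun α => linComb φ α = f‖ * ⨆ x, ‖φ x‖

/-- The projected features `ψ(x) = H φ(x)`. -/
def projFeat {S : Type*} {d D : ℕ} (H : Matrix (Fin d) (Fin D) ℝ)
    (φ : S → EuclideanSpace ℝ (Fin D)) (x : S) : EuclideanSpace ℝ (Fin d) :=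
  Matrix.toEuclideanLin H (φ x)

/-- The law of a `d × D` random matrix (given by its entries) with i.i.d. entries of law
`𝒩(0, 1/d)`. -/
def gaussianMatrix (d D : ℕ) : Measure (Fin d → Fin D → ℝ) :=
  Measure.pi fun _ : Fin d => Measure.pi fun _ : Fin D => gaussianReal 0 (1 / (d : ℝ≥0))

/-- `W` solves the projected multi-step Bellman equation `W = Π_G T^l W`, where `G` is the space
spanned by the randomly projected features. -/
def IsLSTDRP {S A : Type*} [Fintype S] [MeasurableSpace S] [DiscreteMeasurableSpace S] {d D : ℕ}
    (M : MDP S A) (π : S → A) (μ : PMF S) (l : ℝ) (φ : S → EuclideanSpace ℝ (Fin D))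
    (H : Matrix (Fin d) (Fin D) ℝ) (W : S → ℝ) : Prop :=
  W = orthProj μ (featSpace (projFeat H φ)) (M.bellmanTrace π l W)

/-! ### Exponentially `β`-mixing processes -/

/-- A finite partition of `Ω` into events of the `σ`-algebra `m`. -/
def IsPartition {Ω : Type*} (m : MeasurableSpace Ω) {k : ℕ} (B : Fin k → Set Ω) : Prop :=
  (∀ i, MeasurableSet[m] (B i)) ∧ Pairwise (Function.onFun Disjoint B) ∧ ⋃ i, B i = Set.univ

/-- The `β`-mixing (absolute regularity) coefficient of two `σ`-algebras: the supremum of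
`(1/2) ∑ᵢ ∑ⱼ |Pr(Bᵢ ∩ Cⱼ) - Pr(Bᵢ) Pr(Cⱼ)|` over finite partitions `B` in `m₁`, `C` in `m₂`. -/
def betaCoeff {Ω : Type*} [MeasurableSpace Ω] (Pr : Measure Ω) (m₁ m₂ : MeasurableSpace Ω) : ℝ≥0∞ :=
  ⨆ (k : ℕ) (l : ℕ) (B : Fin k → Set Ω) (C : Fin l → Set Ω) (_ : IsPartition m₁ B)
    (_ : IsPartition m₂ C),
    ENNReal.ofReal ((1 / 2) * ∑ i, ∑ j, |Pr.real (B i ∩ C j) - Pr.real (B i) * Pr.real (C j)|)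

/-- The `β`-mixing coefficient of a process at lag `m`: the supremum over `t` of the coefficient
of the past up to `t` and the future from `t + m` on. -/
def betaMixing {Ω S : Type*} [MeasurableSpace Ω] [MeasurableSpace S] (Pr : Measure Ω)
    (X : ℕ → Ω → S) (m : ℕ) : ℝ≥0∞ :=
  ⨆ t : ℕ, betaCoeff Pr (⨆ s : {s : ℕ // s ≤ t}, MeasurableSpace.comap (X s) inferInstance)
    (⨆ s : {s : ℕ // t + m ≤ s}, MeasurableSpace.comap (X s) inferInstance)

/-- A stationary process with `β(m) ≤ β₀ exp(-β₁ m ^ κ)` for all lags `m ≥ 1`. -/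
structure IsStationaryExpMixing {Ω S : Type*} [MeasurableSpace Ω] [MeasurableSpace S]
    (Pr : Measure Ω) (X : ℕ → Ω → S) (β₀ β₁ κ : ℝ) : Prop where
  stationary : Pr.map (fun ω t => X (t + 1) ω) = Pr.map (fun ω t => X t ω)
  mixing : ∀ m : ℕ, 1 ≤ m → betaMixing Pr X m ≤ ENNReal.ofReal (β₀ * Real.exp (-β₁ * (m : ℝ) ^ κ))

/-- `Υ(n, δ) = (log ((4 + n β₀) / δ)) ^ (1 + 1/κ) * β₁ ^ (-1/κ)`. -/
def Upsilon (β₀ β₁ κ : ℝ) (n : ℕ) (δ : ℝ) : ℝ :=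
  Real.log ((4 + n * β₀) / δ) ^ (1 + 1 / κ) * β₁ ^ (-(1 / κ))

end

end LSTDRP

/-!
The proof has a deterministic and a probabilistic half.

*Projected fixed points.* The value function `V` is a fixed point of the Bellman operator
(`bellman_value`, from the Markov property of the law on trajectories), hence of every multi-step
operator. As the transition operator does not increase `‖·‖_μ` for a stationary `μ`, the multi-step
operator contracts this seminorm by `k = γ (1 - λ) / (1 - λ γ)` (`wNorm_bellmanTrace_sub_le`).
Composed with the orthogonal projection onto a space `G` it has a unique fixed point `W`
(`exists_unique_orthProj_fixed`), even when `‖·‖_μ` is only a seminorm, because the chosen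
projection depends only on the `μ`-a.e. class of its argument. The triangle inequality gives
`‖V - W‖ ≤ ‖V - g‖ / (1 - k)` for every `g ∈ G`, and `1 / (1 - k) = (1 - λ γ) / (1 - γ)`
(`exists_unique_projected_bellman`).

*Random projection.* If `Π_F V = f_α`, take for `g` the function with coefficients `H α` in the
projected features. Then `(g - f_α)(x) = ⟨H α, H φ(x)⟩ - ⟨α, φ(x)⟩`, a sum of `d` independent
centred products of Gaussian variables, whose exponential moments are explicit. The function
`y ↦ cosh (c √y)` is convex, so the exponential moment of `‖g - f_α‖_μ` is controlled by the worst
single point `x`, and Markov's inequality gives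
`ℙ (‖g - f_α‖_μ > ε m(f_α)) ≤ 2 exp (-d ε² / 8)` as long as `ε² ≤ 8 / 15`
(`gaussianMatrix_projErr_tail`). With `ε² = (8 / d) log (8 n / δ)` the right-hand side is
`δ / (4 n) ≤ δ`. The average over `μ` is thus controlled directly, and the factor
`1 + 2 √Υ / √n ≥ 1` only enlarges the bound.
-/

namespace LSTDRP

/-! ### Two inequalities for exponential moments -/

/-- Jensen's inequality for `y ↦ cosh (c √y)`, which is convex on `[0, ∞)` because its power series
in `y` has nonnegative coefficients; the inequality is summed term by term over that series. -/
theorem cosh_sqrt_sum_le {S : Type*} [Fintype S] (w z : S → ℝ) (hw : ∀ x, 0 ≤ w x)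
    (hw1 : ∑ x, w x = 1) (c : ℝ) :
    Real.cosh (c * √(∑ x, w x * z x ^ 2)) ≤ ∑ x, w x * Real.cosh (c * z x) := by
  have h2 : HasSum (fun k : ℕ => ∑ x, w x * ((c * z x) ^ (2 * k) / ((2 * k).factorial : ℝ)))
      (∑ x, w x * Real.cosh (c * z x)) :=
    hasSum_sum fun x _ => (Real.hasSum_cosh (c * z x)).mul_left (w x)
  refine hasSum_le (fun k => ?_) (Real.hasSum_cosh _) h2
  have h0 : 0 ≤ ∑ x, w x * z x ^ 2 :=
    Finset.sum_nonneg fun x _ => mul_nonneg (hw x) (sq_nonneg _)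
  have h3 : (∑ x, w x * z x ^ 2) ^ k ≤ ∑ x, w x * (z x ^ 2) ^ k :=
    Real.pow_arith_mean_le_arith_mean_pow Finset.univ w (fun x => z x ^ 2) (fun x _ => hw x) hw1
      (fun x _ => sq_nonneg _) k
  have h4 : ∑ x, w x * ((c * z x) ^ (2 * k) / ((2 * k).factorial : ℝ))
      = c ^ (2 * k) / ((2 * k).factorial : ℝ) * ∑ x, w x * (z x ^ 2) ^ k := by
    rw [Finset.mul_sum]
    refine Finset.sum_congr rfl fun x _ => ?_
    rw [mul_pow, ← pow_mul]; ring
  rw [h4, mul_pow, pow_mul (√_), Real.sq_sqrt h0, mul_div_right_comm]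
  refine mul_le_mul_of_nonneg_left h3 ?_
  rw [pow_mul]; positivity

/-- The right-hand side is the inverse square of the exponential moment of a product of two
Gaussian variables, and this inequality makes that product sub-Gaussian for small parameters. -/
theorem exp_le_sq_sub_sq {a b : ℝ} (hab : |a| ≤ b) (hb : b ^ 2 ≤ 1 / 30) :
    Real.exp (-(2 * a) - 4 * b ^ 2) ≤ (1 - a) ^ 2 - b ^ 2 := by
  obtain ⟨h1, h2⟩ := abs_le.1 hab
  have hb0 : 0 ≤ b := (abs_nonneg a).trans hab
  -- `0.1826` is just above `√(1 / 30)`.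
  have hb1 : b ≤ 0.1826 := by nlinarith
  have ha2 : a ^ 2 ≤ b ^ 2 := sq_le_sq' h1 h2
  set t := 2 * a + 4 * b ^ 2 with ht
  -- For `t ≥ 0` no cubic remainder is needed, and the inequality has little room at `a = b`.
  have hexp : Real.exp (-(2 * a) - 4 * b ^ 2) ≤ 1 - t + t ^ 2 / 2 + 2 / 9 * max 0 (-t) ^ 3 := by
    rw [show -(2 * a) - 4 * b ^ 2 = -t by rw [ht]; ring]
    rcases le_total 0 t with h | h
    · have h5 := Real.quadratic_le_exp_of_nonneg h
      have h6 : Real.exp (-t) * Real.exp t = 1 := by rw [← Real.exp_add]; simp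
      have h7 : 0 < Real.exp (-t) := Real.exp_pos _
      rw [max_eq_left (by linarith)]
      have h8 : 1 ≤ (1 - t + t ^ 2 / 2) * (1 + t + t ^ 2 / 2) := by nlinarith [sq_nonneg (t ^ 2)]
      have h9 : 0 ≤ 1 - t + t ^ 2 / 2 := by nlinarith [sq_nonneg (t - 1)]
      have h10 : (1 - t + t ^ 2 / 2) * (1 + t + t ^ 2 / 2) ≤ (1 - t + t ^ 2 / 2) * Real.exp t :=
        mul_le_mul_of_nonneg_left h5 h9
      have h11 : Real.exp (-t) ≤ 1 - t + t ^ 2 / 2 := by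
        rw [Real.exp_neg, inv_le_iff_one_le_mul₀ (Real.exp_pos _)]
        linarith
      simpa using h11
    · have h5 := Real.exp_bound (x := -t) (by rw [abs_le]; constructor <;> nlinarith)
        (n := 3) (by norm_num)
      rw [max_eq_right (by linarith)]
      rw [abs_of_nonneg (a := -t) (by linarith)] at h5
      have h6 := (abs_le.1 h5).2
      norm_num [Finset.sum_range_succ, Nat.factorial] at h6
      nlinarith
  refine hexp.trans ?_
  rcases le_total 0 t with h | h
  · rw [max_eq_left (by linarith)]
    have h5 : a * b ^ 2 ≤ b * b ^ 2 := mul_le_mul_of_nonneg_right h2 (sq_nonneg _)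
    have h3 : b * b ^ 2 ≤ 0.1826 * b ^ 2 := mul_le_mul_of_nonneg_right hb1 (sq_nonneg _)
    have h4 : b ^ 2 * b ^ 2 ≤ 1 / 30 * b ^ 2 := mul_le_mul_of_nonneg_right hb (sq_nonneg _)
    nlinarith [sq_nonneg b]
  · rw [max_eq_right (by linarith)]
    have ht2 : -t ≤ 2 * b := by nlinarith [sq_nonneg b]
    have h3 : (-t) ^ 3 ≤ (2 * b) ^ 3 := pow_le_pow_left₀ (by linarith) ht2 3
    have h5 : b * b ^ 2 ≤ 0.1826 * b ^ 2 := mul_le_mul_of_nonneg_right hb1 (sq_nonneg _)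
    have h4 : b ^ 2 * b ^ 2 ≤ 1 / 30 * b ^ 2 := mul_le_mul_of_nonneg_right hb (sq_nonneg _)
    have h6 : a * b ^ 2 ≤ 0 :=
      mul_nonpos_of_nonpos_of_nonneg (by nlinarith [sq_nonneg b]) (sq_nonneg _)
    nlinarith [sq_nonneg b]

/-! ### Exponential moments of Gaussian variables -/

theorem lintegral_exp_mul_gaussianReal (v : ℝ≥0) (t : ℝ) :
    ∫⁻ x, ENNReal.ofReal (Real.exp (t * x)) ∂gaussianReal 0 v
      = ENNReal.ofReal (Real.exp (v * t ^ 2 / 2)) := by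
  rw [← ofReal_integral_eq_lintegral_ofReal (integrable_exp_mul_gaussianReal t)
    (ae_of_all _ fun x => (Real.exp_pos _).le)]
  have := congrFun (mgf_fun_id_gaussianReal (μ := 0) (v := v)) t
  simp only [mgf, zero_mul, zero_add] at this
  rw [this]

theorem lintegral_exp_mul_sq_gaussianReal (v : ℝ≥0) (t : ℝ) (h : 0 < 1 - 2 * v * t) :
    ∫⁻ x, ENNReal.ofReal (Real.exp (t * x ^ 2)) ∂gaussianReal 0 v
      = ENNReal.ofReal (√(1 - 2 * v * t))⁻¹ := by
  rcases eq_or_ne v 0 with rfl | hv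
  · simp
  have hv' : (0 : ℝ) < v := by positivity
  have hb : 0 < 1 / (2 * v) - t := by
    rw [sub_pos, lt_div_iff₀ (by positivity)]; linarith
  rw [gaussianReal_of_var_ne_zero _ hv,
    lintegral_withDensity_eq_lintegral_mul _ (measurable_gaussianPDF _ _) (by fun_prop)]
  have hf : ∀ x, (gaussianPDF 0 v * fun x => ENNReal.ofReal (Real.exp (t * x ^ 2))) x
      = ENNReal.ofReal ((√(2 * Real.pi * v))⁻¹ * Real.exp (-(1 / (2 * v) - t) * x ^ 2)) := by
    intro x
    rw [Pi.mul_apply, gaussianPDF, ← ENNReal.ofReal_mul (gaussianPDFReal_nonneg _ _ _),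
      gaussianPDFReal, mul_assoc, ← Real.exp_add]
    congr 3
    field_simp
    ring
  simp_rw [hf]
  rw [← ofReal_integral_eq_lintegral_ofReal ((integrable_exp_neg_mul_sq hb).const_mul _)
    (ae_of_all _ fun x => by positivity), integral_const_mul, integral_gaussian]
  congr 1
  rw [← Real.sqrt_inv, ← Real.sqrt_mul (by positivity), ← Real.sqrt_inv]
  congr 1
  have : 1 / (2 * (v : ℝ)) - t = (1 - 2 * v * t) / (2 * v) := by field_simp
  rw [this]
  field_simp

/-! ### Products of two linear forms in a Gaussian vector -/

section
variable {ι : Type*} [Fintype ι]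

theorem hasGaussianLaw_pi_gaussianReal (v : ℝ≥0) :
    HasGaussianLaw (fun h : ι → ℝ => h) (Measure.pi fun _ : ι => gaussianReal 0 v) := by
  refine iIndepFun.hasGaussianLaw (X := fun i (h : ι → ℝ) => h i) (fun i => ⟨?_⟩) ?_
  · rw [(measurePreserving_eval (fun _ : ι => gaussianReal 0 v) i).map_eq]
    infer_instance
  · exact iIndepFun_pi (X := fun _ => id) (fun _ => aemeasurable_id)

theorem covariance_eval_pi_gaussianReal [DecidableEq ι] (v : ℝ≥0) (i j : ι) :
    cov[fun h : ι → ℝ => h i, fun h => h j; Measure.pi fun _ : ι => gaussianReal 0 v]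
      = if i = j then (v : ℝ) else 0 := by
  have hL : ∀ i, MemLp (fun h : ι → ℝ => h i) 2 (Measure.pi fun _ : ι => gaussianReal 0 v) :=
    fun i => ((hasGaussianLaw_pi_gaussianReal v).eval i).memLp_two
  split_ifs with h
  · subst h
    rw [covariance_self (hL i).aemeasurable]
    have := variance_id_gaussianReal (μ := 0) (v := v)
    rw [← (measurePreserving_eval (fun _ : ι => gaussianReal 0 v) i).map_eq] at this
    exact (variance_map aemeasurable_id (measurable_pi_apply i).aemeasurable).symm.trans this
  · refine IndepFun.covariance_eq_zero ?_ (hL i) (hL j)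
    exact (iIndepFun_pi (X := fun _ => id) (μ := fun _ : ι => gaussianReal 0 v)
      (fun _ => aemeasurable_id)).indepFun h

theorem covariance_dotProduct_pi_gaussianReal (v : ℝ≥0) (p q : ι → ℝ) :
    cov[fun h : ι → ℝ => p ⬝ᵥ h, fun h => q ⬝ᵥ h; Measure.pi fun _ : ι => gaussianReal 0 v]
      = v * p ⬝ᵥ q := by
  classical
  have hL : ∀ (p : ι → ℝ) i, MemLp (fun h : ι → ℝ => p i * h i) 2
      (Measure.pi fun _ : ι => gaussianReal 0 v) :=
    fun p i => ((hasGaussianLaw_pi_gaussianReal v).eval i).memLp_two.const_mul _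
  simp only [dotProduct]
  rw [covariance_fun_sum_fun_sum (hL p) (hL q)]
  simp [covariance_const_mul_left, covariance_const_mul_right, covariance_eval_pi_gaussianReal,
    Finset.mul_sum]
  exact Finset.sum_congr rfl fun i _ => by ring

theorem hasGaussianLaw_dotProduct_prodMk (v : ℝ≥0) (p q : ι → ℝ) :
    HasGaussianLaw (fun h : ι → ℝ => (p ⬝ᵥ h, q ⬝ᵥ h))
      (Measure.pi fun _ : ι => gaussianReal 0 v) := by
  classical
  let L : (ι → ℝ) →L[ℝ] ℝ × ℝ := LinearMap.toContinuousLinearMap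
    ((dotProductBilin ℝ ℝ p).prod (dotProductBilin ℝ ℝ q))
  exact (hasGaussianLaw_pi_gaussianReal v).map_fun L

theorem map_dotProduct_pi_gaussianReal (v : ℝ≥0) (p : ι → ℝ) :
    (Measure.pi fun _ : ι => gaussianReal 0 v).map (fun h => p ⬝ᵥ h)
      = gaussianReal 0 (v * (p ⬝ᵥ p).toNNReal) := by
  have hg := (hasGaussianLaw_dotProduct_prodMk v p p).fst
  have hm : ∫ h, p ⬝ᵥ h ∂(Measure.pi fun _ : ι => gaussianReal 0 v) = 0 := by
    simp only [dotProduct]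
    rw [integral_finsetSum _ fun i _ =>
      ((hasGaussianLaw_pi_gaussianReal v).eval i).integrable.const_mul _]
    refine Finset.sum_eq_zero fun i _ => ?_
    rw [integral_const_mul]
    have := integral_id_gaussianReal (μ := 0) (v := v)
    rw [← (measurePreserving_eval (fun _ : ι => gaussianReal 0 v) i).map_eq,
      integral_map (measurable_pi_apply i).aemeasurable (by fun_prop)] at this
    rw [mul_eq_zero]; right; exact this
  rw [hg.map_eq_gaussianReal, hm, ← covariance_self hg.aemeasurable,
    covariance_dotProduct_pi_gaussianReal, Real.toNNReal_mul v.coe_nonneg, Real.toNNReal_coe]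

/-- The exponential moment of `⟨p, g⟩ ⟨q, g⟩` for a Gaussian vector `g` with i.i.d. entries of
variance `v`. With `q = c p + w` and `w` orthogonal to `p`, the variables `⟨p, g⟩` and `⟨w, g⟩` are
independent; integrating first over `⟨w, g⟩` leaves the exponential of a squared Gaussian. -/
theorem lintegral_exp_dotProduct_mul_dotProduct (v : ℝ≥0) (θ : ℝ) (p q : ι → ℝ)
    (h : 0 < (1 - v * θ * p ⬝ᵥ q) ^ 2 - (v * θ) ^ 2 * ((p ⬝ᵥ p) * (q ⬝ᵥ q))) :
    ∫⁻ g, ENNReal.ofReal (Real.exp (θ * ((p ⬝ᵥ g) * (q ⬝ᵥ g))))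
        ∂(Measure.pi fun _ : ι => gaussianReal 0 v)
      = ENNReal.ofReal (√((1 - v * θ * p ⬝ᵥ q) ^ 2 - (v * θ) ^ 2 * ((p ⬝ᵥ p) * (q ⬝ᵥ q))))⁻¹ := by
  rcases eq_or_ne p 0 with rfl | hp
  · simp
  have hpp : p ⬝ᵥ p ≠ 0 := fun h0 => hp (dotProduct_self_eq_zero.1 h0)
  set P := Measure.pi fun _ : ι => gaussianReal 0 v
  set c := (p ⬝ᵥ q) / (p ⬝ᵥ p)
  set w := q - c • p
  have hpw : p ⬝ᵥ w = 0 := by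
    simp only [w, c, dotProduct_sub, dotProduct_smul, smul_eq_mul]
    field_simp
    ring
  have hww : w ⬝ᵥ w = q ⬝ᵥ q - (p ⬝ᵥ q) ^ 2 / (p ⬝ᵥ p) := by
    simp only [w, c, dotProduct_sub, sub_dotProduct, smul_dotProduct, dotProduct_smul, smul_eq_mul,
      dotProduct_comm q p]
    field_simp
    ring
  have hpp0 : 0 ≤ p ⬝ᵥ p := by simpa using dotProduct_star_self_nonneg p
  have hww0 : 0 ≤ w ⬝ᵥ w := by simpa using dotProduct_star_self_nonneg w
  have hind : IndepFun (fun g => p ⬝ᵥ g) (fun g => w ⬝ᵥ g) P :=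
    (hasGaussianLaw_dotProduct_prodMk v p w).indepFun_of_covariance_eq_zero
      (by rw [covariance_dotProduct_pi_gaussianReal, hpw, mul_zero])
  have hmap := (indepFun_iff_map_prod_eq_prod_map_map
    (by fun_prop) (by fun_prop)).1 hind
  rw [map_dotProduct_pi_gaussianReal, map_dotProduct_pi_gaussianReal] at hmap
  have hq : ∀ g, q ⬝ᵥ g = c * (p ⬝ᵥ g) + w ⬝ᵥ g := fun g => by
    simp [w, sub_dotProduct]
  calc _ = ∫⁻ y, ENNReal.ofReal (Real.exp (θ * (y.1 * (c * y.1 + y.2))))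
        ∂(P.map fun g => (p ⬝ᵥ g, w ⬝ᵥ g)) := by
        rw [lintegral_map (by fun_prop) (by fun_prop)]
        simp_rw [hq]
    _ = ∫⁻ a, ENNReal.ofReal (Real.exp ((θ * c + v * (w ⬝ᵥ w) * θ ^ 2 / 2) * a ^ 2))
        ∂gaussianReal 0 (v * (p ⬝ᵥ p).toNNReal) := by
        rw [hmap, lintegral_prod _ (by fun_prop)]
        refine lintegral_congr fun a => ?_
        have : ∀ b, ENNReal.ofReal (Real.exp (θ * (a * (c * a + b))))
            = ENNReal.ofReal (Real.exp (θ * c * a ^ 2)) *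
              ENNReal.ofReal (Real.exp ((θ * a) * b)) := fun b => by
          rw [← ENNReal.ofReal_mul (Real.exp_pos _).le, ← Real.exp_add]
          congr 2; ring
        simp_rw [this]
        rw [lintegral_const_mul _ (by fun_prop), lintegral_exp_mul_gaussianReal,
          ← ENNReal.ofReal_mul (Real.exp_pos _).le, ← Real.exp_add, NNReal.coe_mul,
          Real.coe_toNNReal _ hww0]
        congr 2; ring
    _ = _ := by
        have hΔ : 1 - 2 * ((v * (p ⬝ᵥ p).toNNReal : ℝ≥0) : ℝ)
              * (θ * c + v * (w ⬝ᵥ w) * θ ^ 2 / 2)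
            = (1 - v * θ * p ⬝ᵥ q) ^ 2 - (v * θ) ^ 2 * ((p ⬝ᵥ p) * (q ⬝ᵥ q)) := by
          rw [NNReal.coe_mul, Real.coe_toNNReal _ hpp0, hww]
          simp only [c]
          field_simp
          ring
        rw [lintegral_exp_mul_sq_gaussianReal _ _ (hΔ ▸ h), hΔ]

/-- The contribution of one row of the random matrix, centred: a sub-Gaussian bound for small
`θ`. -/
theorem lintegral_exp_dotProduct_le (v : ℝ≥0) (θ : ℝ) (p q : ι → ℝ) (s : ℝ)
    (hs : |v * θ| * √((p ⬝ᵥ p) * (q ⬝ᵥ q)) ≤ s) (hs1 : s ^ 2 ≤ 1 / 30) :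
    ∫⁻ g, ENNReal.ofReal (Real.exp (θ * ((p ⬝ᵥ g) * (q ⬝ᵥ g) - v * p ⬝ᵥ q)))
        ∂(Measure.pi fun _ : ι => gaussianReal 0 v)
      ≤ ENNReal.ofReal (Real.exp (2 * s ^ 2)) := by
  have hpp0 : 0 ≤ p ⬝ᵥ p := by simpa using dotProduct_star_self_nonneg p
  have hqq0 : 0 ≤ q ⬝ᵥ q := by simpa using dotProduct_star_self_nonneg q
  set a := v * θ * p ⬝ᵥ q with ha
  set b := |v * θ| * √((p ⬝ᵥ p) * (q ⬝ᵥ q)) with hb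
  have hb0 : 0 ≤ b := by positivity
  have hb2 : b ^ 2 = (v * θ) ^ 2 * ((p ⬝ᵥ p) * (q ⬝ᵥ q)) := by
    rw [hb, mul_pow, sq_abs, Real.sq_sqrt (mul_nonneg hpp0 hqq0)]
  have hbs : b ^ 2 ≤ s ^ 2 := pow_le_pow_left₀ hb0 hs 2
  have hab : |a| ≤ b := by
    rw [ha, abs_mul, hb]
    refine mul_le_mul_of_nonneg_left (Real.abs_le_sqrt ?_) (abs_nonneg _)
    have := Finset.sum_mul_sq_le_sq_mul_sq Finset.univ p q
    simpa [dotProduct, sq] using this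
  have hkey := exp_le_sq_sub_sq hab (hbs.trans hs1)
  have hpos := (Real.exp_pos _).trans_le hkey
  have hsplit : ∀ g : ι → ℝ, ENNReal.ofReal (Real.exp (θ * ((p ⬝ᵥ g) * (q ⬝ᵥ g) - v * p ⬝ᵥ q)))
      = ENNReal.ofReal (Real.exp (-a)) *
        ENNReal.ofReal (Real.exp (θ * ((p ⬝ᵥ g) * (q ⬝ᵥ g)))) := fun g => by
    rw [← ENNReal.ofReal_mul (Real.exp_pos _).le, ← Real.exp_add]
    congr 2; rw [ha]; ring
  simp_rw [hsplit]
  rw [lintegral_const_mul _ (by fun_prop), lintegral_exp_dotProduct_mul_dotProduct v θ p q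
    (by rw [← hb2]; exact hpos), ← hb2, ← ENNReal.ofReal_mul (Real.exp_pos _).le]
  refine ENNReal.ofReal_le_ofReal ?_
  rw [← div_eq_mul_inv, div_le_iff₀ (Real.sqrt_pos.2 hpos)]
  have h1 : Real.exp (-a - 2 * b ^ 2) ≤ √((1 - a) ^ 2 - b ^ 2) := by
    refine Real.le_sqrt_of_sq_le (le_trans (le_of_eq ?_) hkey)
    rw [← Real.exp_nat_mul]; congr 1; push_cast; ring
  calc Real.exp (-a) ≤ Real.exp (2 * s ^ 2) * Real.exp (-a - 2 * b ^ 2) := by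
        rw [← Real.exp_add]; exact Real.exp_le_exp.2 (by linarith)
    _ ≤ _ := mul_le_mul_of_nonneg_left h1 (Real.exp_pos _).le

end

/-! ### Gaussian random projections -/

noncomputable section
variable {d D : ℕ}

/-- The error `⟨H p, H q⟩ - ⟨p, q⟩` of the random projection on the inner product of `p` and `q`,
where the matrix `H` is given by its rows. -/
def projErr (p q : EuclideanSpace ℝ (Fin D)) (H : Fin d → Fin D → ℝ) : ℝ :=
  ∑ i, (p.ofLp ⬝ᵥ H i) * (q.ofLp ⬝ᵥ H i) - p.ofLp ⬝ᵥ q.ofLp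

theorem continuous_projErr (p q : EuclideanSpace ℝ (Fin D)) :
    Continuous (projErr (d := d) p q) := by
  unfold projErr; fun_prop

theorem dotProduct_self_eq_norm_sq (p : EuclideanSpace ℝ (Fin D)) : p.ofLp ⬝ᵥ p.ofLp = ‖p‖ ^ 2 := by
  rw [EuclideanSpace.real_norm_sq_eq]
  simp [dotProduct, sq]

instance (d D : ℕ) : IsProbabilityMeasure (gaussianMatrix d D) := by
  unfold gaussianMatrix; infer_instance

/-- The rows of the random matrix are independent, so the exponential moment of the error is the
product of those of its rows. -/
theorem lintegral_exp_projErr_le (hd : 0 < d) (p q : EuclideanSpace ℝ (Fin D)) (t s : ℝ)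
    (hs : |t| * (‖p‖ * ‖q‖) ≤ s) (hs1 : s ^ 2 ≤ 1 / 30) :
    ∫⁻ H, ENNReal.ofReal (Real.exp (t * d * projErr p q H)) ∂gaussianMatrix d D
      ≤ ENNReal.ofReal (Real.exp (2 * d * s ^ 2)) := by
  have hd' : (d : ℝ) ≠ 0 := by positivity
  let f : (Fin D → ℝ) → ℝ≥0∞ := fun g => ENNReal.ofReal (Real.exp (t * d *
    ((p.ofLp ⬝ᵥ g) * (q.ofLp ⬝ᵥ g) - ((1 / (d : ℝ≥0) : ℝ≥0) : ℝ) * p.ofLp ⬝ᵥ q.ofLp)))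
  have hf : Measurable f := by fun_prop
  have hprod : ∀ H : Fin d → Fin D → ℝ,
      ENNReal.ofReal (Real.exp (t * d * projErr p q H)) = ∏ i, f (H i) := fun H => by
    rw [← ENNReal.ofReal_prod_of_nonneg fun i _ => (Real.exp_pos _).le, ← Real.exp_sum,
      ← Finset.mul_sum, Finset.sum_sub_distrib, projErr]
    simp only [Finset.sum_const, Finset.card_univ, Fintype.card_fin, nsmul_eq_mul]
    congr 4
    push_cast
    field_simp
  simp_rw [hprod]
  have hind : iIndepFun (fun (i : Fin d) (H : Fin d → Fin D → ℝ) => f (H i))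
      (gaussianMatrix d D) :=
    iIndepFun_pi (X := fun _ : Fin d => f) fun _ => hf.aemeasurable
  rw [lintegral_prod_eq_prod_lintegral_of_indepFun Finset.univ _ hind
    fun i => hf.comp (measurable_pi_apply i)]
  have hrow : ∀ i : Fin d, ∫⁻ H, f (H i) ∂gaussianMatrix d D
      ≤ ENNReal.ofReal (Real.exp (2 * s ^ 2)) := fun i => by
    refine ((measurePreserving_eval (fun _ : Fin d => Measure.pi fun _ : Fin D =>
      gaussianReal 0 (1 / (d : ℝ≥0))) i).lintegral_comp hf).le.trans ?_
    refine lintegral_exp_dotProduct_le _ _ _ _ s ?_ hs1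
    rw [dotProduct_self_eq_norm_sq, dotProduct_self_eq_norm_sq, ← mul_pow,
      Real.sqrt_sq (by positivity)]
    convert hs using 3
    push_cast
    field_simp
  calc _ ≤ ∏ _i : Fin d, ENNReal.ofReal (Real.exp (2 * s ^ 2)) :=
        Finset.prod_le_prod' fun i _ => hrow i
    _ = _ := by
        rw [Finset.prod_const, ← ENNReal.ofReal_pow (Real.exp_pos _).le, ← Real.exp_nat_mul]
        simp only [Finset.card_univ, Fintype.card_fin]
        congr 2; ring

theorem lintegral_cosh_projErr_le (hd : 0 < d) (p q : EuclideanSpace ℝ (Fin D)) (t s : ℝ)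
    (hs : |t| * (‖p‖ * ‖q‖) ≤ s) (hs1 : s ^ 2 ≤ 1 / 30) :
    ∫⁻ H, ENNReal.ofReal (Real.cosh (t * d * projErr p q H)) ∂gaussianMatrix d D
      ≤ ENNReal.ofReal (Real.exp (2 * d * s ^ 2)) := by
  have hm := (continuous_projErr (d := d) p q).measurable
  have h : ∀ H : Fin d → Fin D → ℝ, ENNReal.ofReal (Real.cosh (t * d * projErr p q H))
      = ENNReal.ofReal (1 / 2) * (ENNReal.ofReal (Real.exp (t * d * projErr p q H))
        + ENNReal.ofReal (Real.exp (-t * d * projErr p q H))) := fun H => by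
    rw [← ENNReal.ofReal_add (Real.exp_pos _).le (Real.exp_pos _).le,
      ← ENNReal.ofReal_mul (by norm_num), Real.cosh_eq]
    congr 1
    rw [show -(t * d * projErr p q H) = -t * d * projErr p q H by ring]; ring
  simp_rw [h]
  rw [lintegral_const_mul _ (by fun_prop), lintegral_add_left (by fun_prop)]
  calc _ ≤ ENNReal.ofReal (1 / 2) * (ENNReal.ofReal (Real.exp (2 * d * s ^ 2))
        + ENNReal.ofReal (Real.exp (2 * d * s ^ 2))) := by
        gcongr
        · exact lintegral_exp_projErr_le hd p q t s hs hs1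
        · exact lintegral_exp_projErr_le hd p q (-t) s (by rwa [abs_neg]) hs1
    _ = _ := by
        rw [← ENNReal.ofReal_add (Real.exp_pos _).le (Real.exp_pos _).le,
          ← ENNReal.ofReal_mul (by norm_num)]
        congr 1; ring

/-- The weighted quadratic mean of the errors `⟨H p, H q x⟩ - ⟨p, q x⟩` obeys the same tail
bound as a single one: `cosh` of the mean is at most the mean of the `cosh`, so Markov's inequality
only needs the exponential moment of each error, uniformly in `x`. No union bound over the points
is involved. -/
theorem gaussianMatrix_projErr_tail {S : Type*} [Fintype S] (hd : 0 < d) (w : S → ℝ)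
    (hw : ∀ x, 0 ≤ w x) (hw1 : ∑ x, w x = 1) (p : EuclideanSpace ℝ (Fin D))
    (q : S → EuclideanSpace ℝ (Fin D)) (m : ℝ) (hm0 : 0 ≤ m) (hm : ∀ x, ‖p‖ * ‖q x‖ ≤ m)
    (ε : ℝ) (hε : 0 ≤ ε) (hε1 : ε ^ 2 ≤ 8 / 15) :
    gaussianMatrix d D {H | ε * m < √(∑ x, w x * projErr p (q x) H ^ 2)}
      ≤ ENNReal.ofReal (2 * Real.exp (-(d * ε ^ 2 / 8))) := by
  have hmeas : ∀ x, Measurable (projErr (d := d) p (q x)) :=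
    fun x => (continuous_projErr p (q x)).measurable
  rcases hm0.eq_or_lt with rfl | hmpos
  · have hz : ∀ x (H : Fin d → Fin D → ℝ), projErr p (q x) H = 0 := fun x H => by
      rcases mul_eq_zero.1 ((hm x).antisymm (by positivity)) with h | h
      · simp [projErr, norm_eq_zero.1 h]
      · simp [projErr, norm_eq_zero.1 h]
    simp [hz]
  -- The choice `s = ε / 4` minimizes the exponent `2 d s ^ 2 - d s ε` obtained below.
  set s := ε / 4 with hs
  set t := s / m with ht
  have ht0 : 0 ≤ t := by positivity
  have hbound : ∀ x, |t| * (‖p‖ * ‖q x‖) ≤ s := fun x => by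
    rw [abs_of_nonneg ht0, ht, div_mul_eq_mul_div, div_le_iff₀ hmpos]
    exact mul_le_mul_of_nonneg_left (hm x) (by positivity)
  have hs1 : s ^ 2 ≤ 1 / 30 := by rw [hs, div_pow]; linarith
  let F : (Fin d → Fin D → ℝ) → ℝ≥0∞ := fun H =>
    ∑ x, ENNReal.ofReal (w x) * ENNReal.ofReal (Real.cosh (t * d * projErr p (q x) H))
  have hF : ∫⁻ H, F H ∂gaussianMatrix d D ≤ ENNReal.ofReal (Real.exp (2 * d * s ^ 2)) := by
    simp only [F]
    rw [lintegral_finsetSum _ fun x _ => by have := hmeas x; fun_prop]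
    calc _ ≤ ∑ x, ENNReal.ofReal (w x) * ENNReal.ofReal (Real.exp (2 * d * s ^ 2)) := by
          refine Finset.sum_le_sum fun x _ => ?_
          rw [lintegral_const_mul _ (by have := hmeas x; fun_prop)]
          gcongr
          exact lintegral_cosh_projErr_le hd _ _ _ _ (hbound x) hs1
      _ = _ := by
          rw [← Finset.sum_mul, ← ENNReal.ofReal_sum_of_nonneg fun x _ => hw x, hw1,
            ENNReal.ofReal_one, one_mul]
  have hsub : {H | ε * m < √(∑ x, w x * projErr p (q x) H ^ 2)}
      ⊆ {H | ENNReal.ofReal (Real.cosh (d * s * ε)) ≤ F H} := fun H hH => by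
    have h1 := cosh_sqrt_sum_le w (fun x => projErr p (q x) H) hw hw1 (t * d)
    have h2 : Real.cosh (d * s * ε)
        ≤ Real.cosh (t * d * √(∑ x, w x * projErr p (q x) H ^ 2)) := by
      have h3 : d * s * ε = t * d * (ε * m) := by rw [ht]; field_simp
      rw [h3, Real.cosh_le_cosh, abs_of_nonneg (by positivity), abs_of_nonneg (by positivity)]
      exact mul_le_mul_of_nonneg_left (le_of_lt hH) (by positivity)
    refine (ENNReal.ofReal_le_ofReal (h2.trans h1)).trans (le_of_eq ?_)
    rw [ENNReal.ofReal_sum_of_nonneg fun x _ => mul_nonneg (hw x) (Real.cosh_pos _).le]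
    exact Finset.sum_congr rfl fun x _ => ENNReal.ofReal_mul (hw x)
  have hcosh : Real.exp (d * s * ε) / 2 ≤ Real.cosh (d * s * ε) := by
    rw [Real.cosh_eq]; linarith [Real.exp_pos (-(d * s * ε))]
  have hFm : Measurable F :=
    Finset.measurable_fun_sum _ fun x _ => by have := hmeas x; fun_prop
  calc _ ≤ gaussianMatrix d D {H | ENNReal.ofReal (Real.cosh (d * s * ε)) ≤ F H} :=
        measure_mono hsub
    _ ≤ (∫⁻ H, F H ∂gaussianMatrix d D) / ENNReal.ofReal (Real.cosh (d * s * ε)) :=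
        meas_ge_le_lintegral_div hFm.aemeasurable
          (by simpa using Real.cosh_pos _) ENNReal.ofReal_ne_top
    _ ≤ ENNReal.ofReal (Real.exp (2 * d * s ^ 2)) / ENNReal.ofReal (Real.exp (d * s * ε) / 2) := by
        gcongr
    _ = _ := by
        rw [← ENNReal.ofReal_div_of_pos (by positivity)]
        congr 1
        rw [div_div_eq_mul_div, mul_comm _ (2 : ℝ), mul_div_assoc, ← Real.exp_sub, hs]
        congr 2; ring

end

/-! ### The Markov chain, its value function and the Bellman operators -/

noncomputable section

section Chain
variable {S : Type*} [Fintype S]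

/-- The transition operator `(P W) x = ∑ y, P x y * W y` on functions. -/
def transOp (P : S → PMF S) : (S → ℝ) →ₗ[ℝ] (S → ℝ) where
  toFun W := fun x => ∑ y, (P x y).toReal * W y
  map_add' W W' := by ext x; simp [mul_add, Finset.sum_add_distrib]
  map_smul' c W := by
    ext x
    simp only [Pi.smul_apply, smul_eq_mul, RingHom.id_apply, Finset.mul_sum]
    exact Finset.sum_congr rfl fun y _ => by ring

theorem transOp_apply (P : S → PMF S) (W : S → ℝ) (x : S) :
    transOp P W x = ∑ y, (P x y).toReal * W y := rfl

theorem sum_toReal_pmf (p : PMF S) : ∑ x, (p x).toReal = 1 := by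
  rw [← ENNReal.toReal_sum fun x _ => p.apply_ne_top x, ← tsum_fintype (L := .unconditional S),
    p.tsum_coe, ENNReal.toReal_one]

theorem abs_transOp_le (P : S → PMF S) {W : S → ℝ} {C : ℝ} (hW : ∀ x, |W x| ≤ C) (x : S) :
    |transOp P W x| ≤ C := by
  rw [transOp_apply]
  calc _ ≤ ∑ y, |(P x y).toReal * W y| := Finset.abs_sum_le_sum_abs _ _
    _ ≤ ∑ y, (P x y).toReal * C := Finset.sum_le_sum fun y _ => by
        rw [abs_mul, abs_of_nonneg ENNReal.toReal_nonneg]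
        exact mul_le_mul_of_nonneg_left (hW y) ENNReal.toReal_nonneg
    _ = C := by rw [← Finset.sum_mul, sum_toReal_pmf, one_mul]

theorem abs_transOp_iterate_le (P : S → PMF S) {W : S → ℝ} {C : ℝ} (hW : ∀ x, |W x| ≤ C) (t : ℕ)
    (x : S) : |(transOp P)^[t] W x| ≤ C := by
  induction t generalizing x with
  | zero => exact hW x
  | succ t ih => rw [Function.iterate_succ_apply']; exact abs_transOp_le P ih x

theorem exists_abs_le (W : S → ℝ) : ∃ C, ∀ x, |W x| ≤ C :=
  ⟨∑ x, |W x|, fun x => Finset.single_le_sum (f := fun x => |W x|) (fun _ _ => abs_nonneg _)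
    (Finset.mem_univ x)⟩

theorem summable_geometric_mul_iterate {γ : ℝ} (h0 : 0 ≤ γ) (h1 : γ < 1) (P : S → PMF S)
    (W : S → ℝ) (x : S) : Summable fun t : ℕ => γ ^ t * (transOp P)^[t] W x := by
  obtain ⟨C, hC⟩ := exists_abs_le W
  refine Summable.of_norm_bounded ((summable_geometric_of_lt_one h0 h1).mul_right C) fun t => ?_
  rw [Real.norm_eq_abs, abs_mul, abs_of_nonneg (pow_nonneg h0 t)]
  exact mul_le_mul_of_nonneg_left (abs_transOp_iterate_le P hC t x) (pow_nonneg h0 t)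

variable [MeasurableSpace S] [DiscreteMeasurableSpace S]

theorem integral_toMeasure (p : PMF S) (f : S → ℝ) :
    ∫ x, f x ∂p.toMeasure = ∑ x, (p x).toReal * f x := by
  rw [PMF.integral_eq_sum]; rfl

instance (P : S → PMF S) (ν : PMF S) : IsProbabilityMeasure (chainLaw P ν) := by
  unfold chainLaw; infer_instance

theorem integral_chainLaw_zero (P : S → PMF S) (x : S) (f : S → ℝ) :
    ∫ ω, f (ω 0) ∂chainLaw P (PMF.pure x) = f x := by
  have hf : Measurable f := measurable_of_finite f
  set x₀ := (MeasurableEquiv.piUnique fun i : Finset.Iic 0 => (fun _ : ℕ => S) i).symm x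
  have hdirac : Measure.map
      (MeasurableEquiv.piUnique fun i : Finset.Iic 0 => (fun _ : ℕ => S) i).symm
      (Measure.dirac x) = Measure.dirac x₀ := Measure.map_dirac' (MeasurableEquiv.measurable _) x
  rw [chainLaw, Kernel.trajMeasure, PMF.toMeasure_pure,
    hdirac, Measure.dirac_bind (Kernel.measurable _)]
  have h := Kernel.traj_map_frestrictLe_apply (X := fun _ => S) (κ := stepKernel P) 0 0 x₀
  rw [Kernel.partialTraj_self, Kernel.id_apply] at h
  let g : (Finset.Iic 0 → S) → ℝ := fun y => f (y ⟨0, by simp⟩)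
  have hg : ∫ y, g y ∂(Measure.dirac x₀) = f x := by
    rw [integral_dirac]
    rfl
  rw [← hg, ← h, integral_map (by fun_prop) (by fun_prop)]
  rfl

/-- The Markov property: one step of the chain applies the transition operator. -/
theorem integral_chainLaw_succ (P : S → PMF S) (ν : PMF S) (f : S → ℝ) (t : ℕ) :
    ∫ ω, f (ω (t + 1)) ∂chainLaw P ν = ∫ ω, transOp P f (ω t) ∂chainLaw P ν := by
  have hf : Measurable f := measurable_of_finite f
  have hg : Measurable (transOp P f) := measurable_of_finite _
  have h := Kernel.map_frestrictLe_trajMeasure_compProd_eq_map_trajMeasure (X := fun _ => S)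
    (κ := stepKernel P) (μ₀ := ν.toMeasure) (a := t)
  have h1 : ∫ y, f y.2 ∂((chainLaw P ν).map fun ω : ℕ → S =>
      (Preorder.frestrictLe (π := fun _ => S) t ω, ω (t + 1)))
      = ∫ ω, f (ω (t + 1)) ∂chainLaw P ν := by
    rw [integral_map (by fun_prop) (by fun_prop)]
  obtain ⟨C, hC⟩ := exists_abs_le f
  rw [← h1, chainLaw, ← h]
  have : IsProbabilityMeasure ((Kernel.trajMeasure (X := fun _ => S) ν.toMeasure
      (stepKernel P)).map (Preorder.frestrictLe (π := fun _ => S) t)) :=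
    Measure.isProbabilityMeasure_map (by fun_prop)
  rw [Measure.integral_compProd
    (Integrable.of_bound (by fun_prop) C (ae_of_all _ fun y => hC y.2)),
    integral_map (by fun_prop) ?_]
  · refine integral_congr_ae (ae_of_all _ fun ω => ?_)
    exact integral_toMeasure _ _
  · exact (Measurable.stronglyMeasurable (by
      have : (fun x => ∫ y, f (x, y).2 ∂stepKernel P t x)
        = fun x => transOp P f (x ⟨t, by simp⟩) := by
          ext x; exact integral_toMeasure _ _
      rw [this]; fun_prop)).aestronglyMeasurable

theorem integral_chainLaw_pure (P : S → PMF S) (x : S) (f : S → ℝ) (t : ℕ) :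
    ∫ ω, f (ω t) ∂chainLaw P (PMF.pure x) = (transOp P)^[t] f x := by
  induction t generalizing f with
  | zero => exact integral_chainLaw_zero P x f
  | succ t ih => rw [integral_chainLaw_succ, ih, Function.iterate_succ_apply]

end Chain

section MDP
variable {S A : Type*} [Fintype S] (M : MDP S A) (π : S → A)

theorem bellman_eq (W : S → ℝ) :
    M.bellman π W = M.chainReward π + M.γ • transOp (M.chain π) W := rfl

theorem bellman_sub (W W' : S → ℝ) :
    M.bellman π W - M.bellman π W' = M.γ • transOp (M.chain π) (W - W') := by
  rw [bellman_eq, bellman_eq, map_sub, smul_sub]; abel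

theorem bellman_iterate_sub (W W' : S → ℝ) (i : ℕ) :
    (M.bellman π)^[i] W - (M.bellman π)^[i] W'
      = M.γ ^ i • (transOp (M.chain π))^[i] (W - W') := by
  induction i with
  | zero => simp
  | succ i ih =>
    rw [Function.iterate_succ_apply', Function.iterate_succ_apply', bellman_sub, ih, map_smul,
      Function.iterate_succ_apply', smul_smul, pow_succ']

variable [MeasurableSpace S] [DiscreteMeasurableSpace S]

theorem value_eq_tsum (x : S) :
    M.value π x = ∑' t : ℕ, M.γ ^ t * (transOp (M.chain π))^[t] (M.chainReward π) x := by
  obtain ⟨C, hC⟩ := exists_abs_le (M.chainReward π)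
  have hr : Measurable (M.chainReward π) := measurable_of_finite _
  have hγ := M.γ_pos.le
  have hint : ∀ t : ℕ, Integrable (fun ω : ℕ → S => M.γ ^ t * M.chainReward π (ω t))
      (chainLaw (M.chain π) (PMF.pure x)) := fun t =>
    (Integrable.of_bound (f := fun ω : ℕ → S => M.chainReward π (ω t))
      (hr.comp (measurable_pi_apply t)).aestronglyMeasurable C
      (ae_of_all _ fun ω => hC (ω t))).const_mul _
  rw [MDP.value, ← integral_tsum_of_summable_integral_norm hint]
  · refine tsum_congr fun t => ?_
    rw [integral_const_mul, integral_chainLaw_pure]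
  · refine Summable.of_nonneg_of_le (fun t => integral_nonneg fun _ => norm_nonneg _) (fun t => ?_)
      ((summable_geometric_of_lt_one hγ M.γ_lt_one).mul_right C)
    calc _ ≤ ∫ _, M.γ ^ t * C ∂(chainLaw (M.chain π) (PMF.pure x)) := by
          refine integral_mono (hint t).norm (integrable_const _) fun ω => ?_
          simp only [Real.norm_eq_abs, abs_mul, abs_of_nonneg (pow_nonneg hγ t)]
          exact mul_le_mul_of_nonneg_left (hC _) (pow_nonneg hγ t)
      _ = _ := by simp

theorem bellman_value : M.bellman π (M.value π) = M.value π := by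
  have hs := summable_geometric_mul_iterate M.γ_pos.le M.γ_lt_one (M.chain π) (M.chainReward π)
  ext x
  rw [value_eq_tsum M π x, (hs x).tsum_eq_zero_add, bellman_eq]
  simp only [Pi.add_apply, Pi.smul_apply, smul_eq_mul, pow_zero, one_mul,
    Function.iterate_zero, id_eq]
  congr 1
  rw [transOp_apply]
  simp_rw [value_eq_tsum M π, ← tsum_mul_left]
  rw [← Summable.tsum_finsetSum fun y _ => ((hs y).mul_left _), ← tsum_mul_left]
  refine tsum_congr fun t => ?_
  rw [Function.iterate_succ_apply', transOp_apply, Finset.mul_sum, Finset.mul_sum]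
  exact Finset.sum_congr rfl fun y _ => by ring

theorem bellmanTrace_value {l : ℝ} (h0 : 0 ≤ l) (h1 : l ≤ 1) :
    M.bellmanTrace π l (M.value π) = M.value π := by
  unfold MDP.bellmanTrace
  split_ifs with h
  · rfl
  have hl : l < 1 := lt_of_le_of_ne h1 h
  ext x
  have : ∀ i : ℕ, (M.bellman π)^[i + 1] (M.value π) = M.value π := fun i =>
    Function.iterate_fixed (bellman_value M π) _
  simp_rw [this]
  rw [tsum_mul_right, tsum_geometric_of_lt_one h0 hl, ← mul_assoc,
    mul_inv_cancel₀ (by linarith), one_mul]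

theorem summable_bellman_iterate {l : ℝ} (h0 : 0 ≤ l) (h1 : l < 1) (W : S → ℝ) (x : S) :
    Summable fun i : ℕ => l ^ i * (M.bellman π)^[i + 1] W x := by
  have h2 : ∀ i : ℕ, l ^ i * (M.bellman π)^[i + 1] W x
      = l ^ i * M.value π x + (l * M.γ) ^ i *
        (transOp (M.chain π))^[i] (M.γ • transOp (M.chain π) (W - M.value π)) x := fun i => by
    -- The iterates are the constant `V` plus a discounted iterate of the transition operator.
    have h3 := bellman_iterate_sub M π W (M.value π) (i + 1)
    rw [Function.iterate_fixed (bellman_value M π), sub_eq_iff_eq_add] at h3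
    have h4 : (transOp (M.chain π))^[i] (M.γ • transOp (M.chain π) (W - M.value π))
        = M.γ • (transOp (M.chain π))^[i + 1] (W - M.value π) := by
      rw [← Module.End.pow_apply, map_smul, Module.End.pow_apply, ← Function.iterate_succ_apply]
    rw [h3, h4]
    simp only [Pi.add_apply, Pi.smul_apply, smul_eq_mul]
    ring
  simp_rw [h2]
  refine ((summable_geometric_of_lt_one h0 h1).mul_right _).add ?_
  have hlg : l * M.γ < 1 := by nlinarith [M.γ_lt_one, M.γ_pos]
  exact summable_geometric_mul_iterate (mul_nonneg h0 M.γ_pos.le) hlg _ _ x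

/-- For `l < 1` the multi-step operator solves `U = (1 - l) T W + l T U` with `T` the one-step
operator. This recursion yields its contraction factor without summing a series of norms. -/
theorem bellmanTrace_eq {l : ℝ} (h0 : 0 ≤ l) (h1 : l < 1) (W : S → ℝ) :
    M.bellmanTrace π l W
      = (1 - l) • M.bellman π W + l • M.bellman π (M.bellmanTrace π l W) := by
  have hs := summable_bellman_iterate M π h0 h1 W
  have hT : ∀ x, M.bellmanTrace π l W x
      = (1 - l) * ∑' i : ℕ, l ^ i * (M.bellman π)^[i + 1] W x := fun x => by
    rw [MDP.bellmanTrace, if_neg h1.ne]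
  ext x
  rw [hT x, (hs x).tsum_eq_zero_add]
  simp only [Pi.add_apply, Pi.smul_apply, smul_eq_mul, pow_zero, one_mul, zero_add,
    Function.iterate_one, mul_add]
  congr 1
  rw [bellman_eq]
  simp only [Pi.add_apply, Pi.smul_apply, smul_eq_mul]
  rw [transOp_apply]
  have hgeo : M.chainReward π x = (1 - l) * ∑' i : ℕ, l ^ i * M.chainReward π x := by
    rw [tsum_mul_right, tsum_geometric_of_lt_one h0 h1, ← mul_assoc,
      mul_inv_cancel₀ (by linarith), one_mul]
  have h5 : ∑ y, (M.chain π x y).toReal * M.bellmanTrace π l W y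
      = (1 - l) * ∑' i : ℕ, l ^ i * transOp (M.chain π) ((M.bellman π)^[i + 1] W) x := by
    simp_rw [hT, mul_left_comm _ (1 - l), ← Finset.mul_sum]
    congr 1
    simp_rw [← tsum_mul_left]
    rw [← Summable.tsum_finsetSum fun y _ => ((hs y).mul_left _)]
    refine tsum_congr fun t => ?_
    rw [transOp_apply, Finset.mul_sum]
    exact Finset.sum_congr rfl fun y _ => by ring
  have hs5 : Summable fun i : ℕ => l ^ i * transOp (M.chain π) ((M.bellman π)^[i + 1] W) x := by
    have h6 : Summable fun i : ℕ => ∑ y, (M.chain π x y).toReal *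
        (l ^ i * (M.bellman π)^[i + 1] W y) := summable_sum fun y _ => (hs y).mul_left _
    refine h6.congr fun i => ?_
    rw [transOp_apply, Finset.mul_sum]
    exact Finset.sum_congr rfl fun y _ => by ring
  have hs6 : Summable fun i : ℕ => l ^ i * M.chainReward π x :=
    (summable_geometric_of_lt_one h0 h1).mul_right _
  have h7 : ∑' i : ℕ, l ^ (i + 1) * (M.bellman π)^[i + 1 + 1] W x
      = l * (∑' i : ℕ, l ^ i * M.chainReward π x + M.γ *
        ∑' i : ℕ, l ^ i * transOp (M.chain π) ((M.bellman π)^[i + 1] W) x) := by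
    rw [← tsum_mul_left (a := M.γ), ← hs6.tsum_add (hs5.mul_left _), ← tsum_mul_left]
    refine tsum_congr fun i => ?_
    rw [Function.iterate_succ_apply', bellman_eq]
    simp only [Pi.add_apply, Pi.smul_apply, smul_eq_mul]
    ring
  rw [h5, h7]
  linear_combination (-l) * hgeo

end MDP

end

/-! ### The weighted seminorm and projected fixed points -/

noncomputable section

section Weighted
variable {S : Type*} (μ : PMF S)

/-- The map `f ↦ (√(μ x) f x)ₓ`, an isometry from the functions on `S` with the seminorm `‖·‖_μ` to
the Euclidean space `ℝ^S`. -/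
def weightedEmb : (S → ℝ) →ₗ[ℝ] EuclideanSpace ℝ S where
  toFun f := WithLp.toLp 2 fun x => √(μ x).toReal * f x
  map_add' f g := by ext x; simp [mul_add]
  map_smul' c f := by ext x; simp; ring

theorem weightedEmb_apply (f : S → ℝ) (x : S) : weightedEmb μ f x = √(μ x).toReal * f x := rfl

variable [Fintype S]

theorem inner_weightedEmb (f g : S → ℝ) :
    inner ℝ (weightedEmb μ f) (weightedEmb μ g) = wInner μ f g := by
  simp only [wInner, PiLp.inner_apply, weightedEmb_apply]
  refine Finset.sum_congr rfl fun x _ => ?_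
  have := Real.mul_self_sqrt (ENNReal.toReal_nonneg (a := μ x))
  simp only [RCLike.inner_apply, conj_trivial]
  linear_combination (f x * g x) * this

theorem norm_weightedEmb (f : S → ℝ) : ‖weightedEmb μ f‖ = wNorm μ f := by
  rw [norm_eq_sqrt_real_inner, inner_weightedEmb, wInner, wNorm]
  congr 1
  exact Finset.sum_congr rfl fun x _ => by ring

theorem wNorm_nonneg (f : S → ℝ) : 0 ≤ wNorm μ f := Real.sqrt_nonneg _

theorem wNorm_add_le (f g : S → ℝ) : wNorm μ (f + g) ≤ wNorm μ f + wNorm μ g := by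
  simp only [← norm_weightedEmb, map_add]
  exact norm_add_le _ _

theorem wNorm_smul (c : ℝ) (f : S → ℝ) : wNorm μ (c • f) = |c| * wNorm μ f := by
  simp only [← norm_weightedEmb, map_smul, norm_smul, Real.norm_eq_abs]

theorem wNorm_sub_rev (f g : S → ℝ) : wNorm μ (f - g) = wNorm μ (g - f) := by
  simp only [← norm_weightedEmb, map_sub]
  exact norm_sub_rev _ _

theorem wInner_eq_zero_of_wNorm_eq_zero {f : S → ℝ} (hf : wNorm μ f = 0) (g : S → ℝ) :
    wInner μ f g = 0 := by
  rw [← norm_weightedEmb, norm_eq_zero] at hf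
  rw [← inner_weightedEmb, hf, inner_zero_left]

variable {μ} {F : Submodule ℝ (S → ℝ)}

theorem IsOrthProj.wNorm_sub_le {f g h : S → ℝ} (hg : IsOrthProj μ F f g) (hh : h ∈ F) :
    wNorm μ (f - g) ≤ wNorm μ (f - h) := by
  have h0 := hg.2 _ (F.sub_mem hg.1 hh)
  rw [← inner_weightedEmb] at h0
  have h1 := norm_add_sq_eq_norm_sq_add_norm_sq_of_inner_eq_zero _ _ h0
  rw [← map_add, sub_add_sub_cancel, norm_weightedEmb, norm_weightedEmb, norm_weightedEmb] at h1
  exact abs_le_of_sq_le_sq' (by nlinarith [mul_self_nonneg (wNorm μ (g - h))])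
    (wNorm_nonneg μ _) |>.2

theorem IsOrthProj.wNorm_sub_le_of_both {f f' g g' : S → ℝ} (hg : IsOrthProj μ F f g)
    (hg' : IsOrthProj μ F f' g') : wNorm μ (g - g') ≤ wNorm μ (f - f') := by
  have hd := F.sub_mem hg.1 hg'.1
  have h0 : inner ℝ (weightedEmb μ ((f - f') - (g - g'))) (weightedEmb μ (g - g')) = 0 := by
    have h1 := hg.2 _ hd
    have h2 := hg'.2 _ hd
    rw [← inner_weightedEmb] at h1 h2
    rw [show (f - f') - (g - g') = (f - g) - (f' - g') by abel, map_sub, inner_sub_left, h1, h2,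
      sub_zero]
  have h1 := norm_add_sq_eq_norm_sq_add_norm_sq_of_inner_eq_zero _ _ h0
  rw [← map_add, sub_add_cancel, norm_weightedEmb, norm_weightedEmb, norm_weightedEmb] at h1
  exact abs_le_of_sq_le_sq' (by nlinarith [mul_self_nonneg (wNorm μ (f - f' - (g - g')))])
    (wNorm_nonneg μ _) |>.2

/-- `orthProj` is chosen from the predicate `IsOrthProj μ F f`, which depends on `f` only up to
functions of seminorm zero; so the choice is the same for both. -/
theorem orthProj_congr {f f' : S → ℝ} (h : wNorm μ (f - f') = 0) :
    orthProj μ F f = orthProj μ F f' := by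
  have : IsOrthProj μ F f = IsOrthProj μ F f' := by
    ext g
    refine and_congr_right fun _ => forall₂_congr fun k _ => ?_
    have h1 := wInner_eq_zero_of_wNorm_eq_zero μ h k
    rw [← inner_weightedEmb] at h1 ⊢
    rw [← inner_weightedEmb, ← sub_add_sub_cancel f f' g, map_add, inner_add_left, h1, zero_add]
  rw [orthProj, orthProj, this]

/-- A map which contracts the seminorm `‖·‖_μ` becomes, after projection, a map with exactly one
fixed point, although `‖·‖_μ` need not separate points: the projection `Π_F f` depends on `f` only
through its `μ`-a.e. class. -/
theorem exists_unique_orthProj_fixed (F : Submodule ℝ (S → ℝ)) {T : (S → ℝ) → S → ℝ} {k : ℝ}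
    (hk0 : 0 ≤ k) (hk1 : k < 1) (hT : ∀ W W', wNorm μ (T W - T W') ≤ k * wNorm μ (W - W')) :
    ∃ W, W = orthProj μ F (T W) ∧ ∀ W', W' = orthProj μ F (T W') → W' = W := by
  have hproj : ∀ f f', wNorm μ (orthProj μ F f - orthProj μ F f') ≤ wNorm μ (f - f') :=
    fun f f' => (isOrthProj_orthProj μ F f).wNorm_sub_le_of_both (isOrthProj_orthProj μ F f')
  have hT0 : ∀ W W', wNorm μ (W - W') = 0 → wNorm μ (T W - T W') = 0 := fun W W' h =>
    le_antisymm ((hT W W').trans (by rw [h, mul_zero])) (wNorm_nonneg μ _)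
  -- A section of `weightedEmb μ` up to null functions; the junk value `v x / 0 = 0` off the support
  -- of `μ` is harmless.
  let lift : EuclideanSpace ℝ S → S → ℝ := fun v x => v x / √(μ x).toReal
  have hlift : ∀ v v', wNorm μ (lift v - lift v') ≤ ‖v - v'‖ := fun v v' => by
    rw [wNorm, EuclideanSpace.norm_eq]
    refine Real.sqrt_le_sqrt (Finset.sum_le_sum fun x _ => ?_)
    simp only [lift, Pi.sub_apply, PiLp.sub_apply, Real.norm_eq_abs, sq_abs, ← sub_div, div_pow,
      Real.sq_sqrt ENNReal.toReal_nonneg]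
    rcases eq_or_ne (μ x).toReal 0 with h | h
    · simp only [h, mul_zero]; positivity
    · rw [div_mul_cancel₀ _ h]
  have hlift_emb : ∀ f, wNorm μ (f - lift (weightedEmb μ f)) = 0 := fun f => by
    rw [wNorm, Real.sqrt_eq_zero', Finset.sum_eq_zero]
    intro x _
    rcases eq_or_ne (μ x).toReal 0 with h | h
    · simp [h]
    · have h' : √(μ x).toReal ≠ 0 := (Real.sqrt_ne_zero ENNReal.toReal_nonneg).2 h
      simp only [lift, weightedEmb_apply, Pi.sub_apply]
      rw [mul_div_cancel_left₀ _ h', sub_self]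
      simp
  let Φ : EuclideanSpace ℝ S → EuclideanSpace ℝ S := fun v =>
    weightedEmb μ (orthProj μ F (T (lift v)))
  have hΦ : ContractingWith ⟨k, hk0⟩ Φ := by
    refine ⟨by exact_mod_cast hk1, LipschitzWith.of_dist_le_mul fun v v' => ?_⟩
    rw [dist_eq_norm, dist_eq_norm, ← map_sub, norm_weightedEmb]
    calc _ ≤ wNorm μ (T (lift v) - T (lift v')) := hproj _ _
      _ ≤ k * wNorm μ (lift v - lift v') := hT _ _
      _ ≤ k * ‖v - v'‖ := mul_le_mul_of_nonneg_left (hlift v v') hk0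
  set v := ContractingWith.fixedPoint Φ hΦ
  have hv : weightedEmb μ (orthProj μ F (T (lift v))) = v := hΦ.fixedPoint_isFixedPt
  refine ⟨orthProj μ F (T (lift v)), ?_, fun W' hW' => ?_⟩
  · have h := hlift_emb (orthProj μ F (T (lift v)))
    rw [hv, wNorm_sub_rev] at h
    exact orthProj_congr (hT0 _ _ h)
  · set W := orthProj μ F (T (lift v))
    have hW : W = orthProj μ F (T W) := by
      have h := hlift_emb W
      rw [hv, wNorm_sub_rev] at h
      exact orthProj_congr (hT0 _ _ h)
    have h1 : wNorm μ (W' - W) ≤ k * wNorm μ (W' - W) := by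
      conv_lhs => rw [hW', hW]
      exact (hproj _ _).trans (hT _ _)
    have h2 : wNorm μ (W' - W) = 0 := by nlinarith [wNorm_nonneg μ (W' - W)]
    rw [hW', hW]
    exact orthProj_congr (hT0 _ _ h2)

end Weighted

section Contraction
variable {S : Type*} [Fintype S] {μ : PMF S} {P : S → PMF S}

/-- When `μ` is stationary the transition operator does not increase `‖·‖_μ`, by Jensen's
inequality. -/
theorem wNorm_transOp_le (hμ : μ.bind P = μ) (W : S → ℝ) :
    wNorm μ (transOp P W) ≤ wNorm μ W := by
  have hstat : ∀ y, ∑ x, (μ x).toReal * (P x y).toReal = (μ y).toReal := fun y => by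
    conv_rhs => rw [← hμ, PMF.bind_apply, tsum_fintype,
      ENNReal.toReal_sum fun x _ => ENNReal.mul_ne_top (μ.apply_ne_top x) ((P x).apply_ne_top y)]
    simp only [ENNReal.toReal_mul]
  rw [wNorm, wNorm]
  refine Real.sqrt_le_sqrt ?_
  calc ∑ x, transOp P W x ^ 2 * (μ x).toReal
      ≤ ∑ x, (∑ y, (P x y).toReal * W y ^ 2) * (μ x).toReal := by
        refine Finset.sum_le_sum fun x _ => mul_le_mul_of_nonneg_right ?_ ENNReal.toReal_nonneg
        exact Real.pow_arith_mean_le_arith_mean_pow_of_even Finset.univ (fun y => (P x y).toReal) W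
          (fun _ _ => ENNReal.toReal_nonneg) (sum_toReal_pmf (P x)) even_two
    _ = ∑ y, W y ^ 2 * (μ y).toReal := by
        simp_rw [Finset.sum_mul]
        rw [Finset.sum_comm]
        refine Finset.sum_congr rfl fun y _ => ?_
        rw [← hstat y, Finset.mul_sum]
        exact Finset.sum_congr rfl fun x _ => by ring

variable {A : Type*} (M : MDP S A) (π : S → A)

theorem wNorm_bellman_sub_le (hμ : μ.bind (M.chain π) = μ) (W W' : S → ℝ) :
    wNorm μ (M.bellman π W - M.bellman π W') ≤ M.γ * wNorm μ (W - W') := by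
  rw [bellman_sub, wNorm_smul, abs_of_pos M.γ_pos]
  exact mul_le_mul_of_nonneg_left (wNorm_transOp_le hμ _) M.γ_pos.le

variable [MeasurableSpace S] [DiscreteMeasurableSpace S]

theorem wNorm_bellmanTrace_sub_le (hμ : μ.bind (M.chain π) = μ) {l : ℝ} (h0 : 0 ≤ l) (h1 : l ≤ 1)
    (W W' : S → ℝ) :
    wNorm μ (M.bellmanTrace π l W - M.bellmanTrace π l W')
      ≤ M.γ * (1 - l) / (1 - l * M.γ) * wNorm μ (W - W') := by
  have hlg : 0 < 1 - l * M.γ := by nlinarith [M.γ_lt_one, M.γ_pos]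
  rcases h1.eq_or_lt with rfl | hl
  · simp [MDP.bellmanTrace, wNorm]
  set U := M.bellmanTrace π l W with hU
  set U' := M.bellmanTrace π l W' with hU'
  have hdiff : U - U' = (1 - l) • (M.bellman π W - M.bellman π W')
      + l • (M.bellman π U - M.bellman π U') := by
    conv_lhs => rw [hU, hU', bellmanTrace_eq M π h0 hl W, bellmanTrace_eq M π h0 hl W']
    module
  have hle : wNorm μ (U - U') ≤ (1 - l) * (M.γ * wNorm μ (W - W'))
      + l * (M.γ * wNorm μ (U - U')) := by
    conv_lhs => rw [hdiff]
    refine (wNorm_add_le μ _ _).trans ?_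
    rw [wNorm_smul, wNorm_smul, abs_of_nonneg h0, abs_of_nonneg (by linarith)]
    exact add_le_add
      (mul_le_mul_of_nonneg_left (wNorm_bellman_sub_le M π hμ W W') (by linarith))
      (mul_le_mul_of_nonneg_left (wNorm_bellman_sub_le M π hμ U U') h0)
  rw [div_mul_eq_mul_div, le_div_iff₀ hlg]
  linarith

/-- The error of the fixed point of the projected multi-step Bellman equation, in terms of the
distance from the value function to the approximation space. -/
theorem exists_unique_projected_bellman (hμ : μ.bind (M.chain π) = μ) {l : ℝ} (h0 : 0 ≤ l)
    (h1 : l ≤ 1) (F : Submodule ℝ (S → ℝ)) :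
    ∃ W, W = orthProj μ F (M.bellmanTrace π l W) ∧
      (∀ W', W' = orthProj μ F (M.bellmanTrace π l W') → W' = W) ∧
      ∀ g ∈ F, wNorm μ (M.value π - W) ≤ (1 - l * M.γ) / (1 - M.γ) * wNorm μ (M.value π - g) := by
  have hγ := M.γ_pos
  have hγ1 := M.γ_lt_one
  have hlg : 0 < 1 - l * M.γ := by nlinarith
  set k := M.γ * (1 - l) / (1 - l * M.γ) with hk
  have hk0 : 0 ≤ k := div_nonneg (mul_nonneg hγ.le (by linarith)) hlg.le
  have hk1 : k < 1 := by rw [hk, div_lt_one hlg]; linarith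
  have hT := wNorm_bellmanTrace_sub_le M π hμ h0 h1
  obtain ⟨W, hW, huniq⟩ := exists_unique_orthProj_fixed F hk0 hk1 hT
  refine ⟨W, hW, huniq, fun g hg => ?_⟩
  set V := M.value π
  have hV := isOrthProj_orthProj μ F V
  have hWp : IsOrthProj μ F (M.bellmanTrace π l W) W := by
    conv => arg 4; rw [hW]
    exact isOrthProj_orthProj μ F _
  have h2 : wNorm μ (orthProj μ F V - W) ≤ k * wNorm μ (V - W) := by
    refine (hV.wNorm_sub_le_of_both hWp).trans ?_
    have h3 := hT V W
    rwa [bellmanTrace_value M π h0 h1] at h3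
  have h4 : wNorm μ (V - W) ≤ wNorm μ (V - g) + k * wNorm μ (V - W) := by
    have h5 := wNorm_add_le μ (V - orthProj μ F V) (orthProj μ F V - W)
    rw [sub_add_sub_cancel] at h5
    linarith [hV.wNorm_sub_le hg]
  have h6 : 1 - k = (1 - M.γ) / (1 - l * M.γ) := by
    have h8 : k * (1 - l * M.γ) = M.γ * (1 - l) := div_mul_cancel₀ _ hlg.ne'
    rw [eq_div_iff hlg.ne']
    linarith
  have h7 : (1 - k) * wNorm μ (V - W) ≤ wNorm μ (V - g) := by linarith
  rw [h6, div_mul_eq_mul_div, div_le_iff₀ hlg] at h7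
  rw [div_mul_eq_mul_div, le_div_iff₀ (by linarith)]
  linarith

end Contraction

end

end LSTDRP

/-! ### The error bound -/

theorem theorem5 {S A : Type*} [Fintype S] [MeasurableSpace S] [DiscreteMeasurableSpace S]
    [Finite A] (M : LSTDRP.MDP S A) (π : S → A)
    -- the steady-state law of the induced chain
    (μ : PMF S) (hμ : μ.bind (M.chain π) = μ)
    -- the features, linearly independent, and the dimensions
    (D d : ℕ) (hdD : d < D) (φ : S → EuclideanSpace ℝ (Fin D))
    (hφ : LinearIndependent ℝ fun (i : Fin D) (x : S) => φ x i)
    -- the chain, with times counted from `0`: initial law `μ`, stationary and exponentially mixing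
    {Ω : Type*} [MeasurableSpace Ω] (Pr : MeasureTheory.Measure Ω)
    [MeasureTheory.IsProbabilityMeasure Pr] (X : ℕ → Ω → S) (hX : ∀ t, Measurable (X t))
    (hchain : Pr.map (fun ω t => X t ω) = LSTDRP.chainLaw (M.chain π) μ)
    (β₀ β₁ κ : ℝ) (hβ₀ : 0 < β₀) (hβ₁ : 0 < β₁) (hκ : 0 < κ)
    (hmix : LSTDRP.IsStationaryExpMixing Pr X β₀ β₁ κ)
    (l : ℝ) (hl : l ∈ Set.Icc (0 : ℝ) 1) (δ : ℝ) (hδ : δ ∈ Set.Ioo (0 : ℝ) 1)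
    (n : ℕ) (hn : 1 ≤ n) (hd : 15 * Real.log (8 * n / δ) ≤ d) :
    ∃ E : Set (Fin d → Fin D → ℝ), MeasurableSet E ∧
      ENNReal.ofReal (1 - δ) ≤ LSTDRP.gaussianMatrix d D E ∧
      ∀ H ∈ E, ∃ W : S → ℝ,
        LSTDRP.IsLSTDRP M π μ l φ (Matrix.of H) W ∧
        (∀ W' : S → ℝ, LSTDRP.IsLSTDRP M π μ l φ (Matrix.of H) W' → W' = W) ∧
        LSTDRP.wNorm μ (M.value π - W) ≤ (1 - l * M.γ) / (1 - M.γ) *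
          (LSTDRP.wNorm μ (M.value π - LSTDRP.orthProj μ (LSTDRP.featSpace φ) (M.value π)) +
            √(8 / d * Real.log (8 * n / δ)) *
              (1 + 2 * √(LSTDRP.Upsilon β₀ β₁ κ n (δ / 2)) / √n) *
              LSTDRP.mFactor φ (LSTDRP.orthProj μ (LSTDRP.featSpace φ) (M.value π))) := by
  obtain ⟨hδ0, hδ1⟩ := hδ
  have hn1 : (1 : ℝ) ≤ n := by exact_mod_cast hn
  set L := Real.log (8 * n / δ) with hL
  have harg : 8 < 8 * n / δ := by rw [lt_div_iff₀ hδ0]; nlinarith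
  have hL0 : 0 < L := Real.log_pos (by linarith)
  have hd0 : (0 : ℝ) < d := by linarith
  have hd0' : 0 < d := by exact_mod_cast hd0
  have hγ1 := M.γ_lt_one
  have hlg : 0 ≤ 1 - l * M.γ := by nlinarith [hl.1, hl.2, M.γ_pos]
  set ε := √(8 / d * L) with hε
  have hε2 : ε ^ 2 = 8 / d * L := Real.sq_sqrt (by positivity)
  have hε0 : 0 ≤ ε := Real.sqrt_nonneg _
  -- This is where `d ≥ 15 log (8 n / δ)` enters.
  have hε1 : ε ^ 2 ≤ 8 / 15 := by
    rw [hε2, div_mul_eq_mul_div, div_le_iff₀ hd0]; linarith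
  set f := LSTDRP.orthProj μ (LSTDRP.featSpace φ) (M.value π) with hf
  set α := Classical.epsilon fun α => LSTDRP.linComb φ α = f with hα
  have hαf : LSTDRP.linComb φ α = f :=
    Classical.epsilon_spec (LinearMap.mem_range.1
      (LSTDRP.isOrthProj_orthProj μ (LSTDRP.featSpace φ) (M.value π)).1)
  set m := LSTDRP.mFactor φ f with hm
  have hm_eq : m = ‖α‖ * ⨆ x, ‖φ x‖ := rfl
  have hm0 : 0 ≤ m := mul_nonneg (norm_nonneg _) (Real.iSup_nonneg fun x => norm_nonneg _)
  have hmx : ∀ x, ‖α‖ * ‖φ x‖ ≤ m := fun x =>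
    mul_le_mul_of_nonneg_left (le_ciSup (Set.finite_range fun x => ‖φ x‖).bddAbove x)
      (norm_nonneg _)
  -- Matrices for which the random projection of `f = f_α` is close to `f` in `‖·‖_μ`.
  let E : Set (Fin d → Fin D → ℝ) :=
    {H | √(∑ x, (μ x).toReal * LSTDRP.projErr α (φ x) H ^ 2) ≤ ε * m}
  have hE : MeasurableSet E := by
    have hc : ∀ x, Measurable (LSTDRP.projErr (d := d) α (φ x)) :=
      fun x => (LSTDRP.continuous_projErr α (φ x)).measurable
    refine measurableSet_le ?_ measurable_const
    exact (Finset.measurable_fun_sum _ fun x _ => ((hc x).pow_const 2).const_mul _).sqrt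
  refine ⟨E, hE, ?_, fun H hH => ?_⟩
  · have htail := LSTDRP.gaussianMatrix_projErr_tail hd0' (fun x => (μ x).toReal)
      (fun x => ENNReal.toReal_nonneg) (LSTDRP.sum_toReal_pmf μ) α φ m hm0 hmx ε hε0 hε1
    have hcompl : {H : Fin d → Fin D → ℝ |
        ε * m < √(∑ x, (μ x).toReal * LSTDRP.projErr α (φ x) H ^ 2)} = Eᶜ := by
      ext H; simp [E]
    have hexp : 2 * Real.exp (-(d * ε ^ 2 / 8)) ≤ δ := by
      have h1 : d * ε ^ 2 / 8 = L := by rw [hε2]; field_simp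
      rw [h1, Real.exp_neg, hL, Real.exp_log (by linarith), inv_div, ← mul_div_assoc,
        div_le_iff₀ (by linarith)]
      nlinarith
    rw [hcompl] at htail
    have h2 := htail.trans (ENNReal.ofReal_le_ofReal hexp)
    rw [MeasureTheory.prob_compl_eq_one_sub hE] at h2
    rw [ENNReal.ofReal_sub _ hδ0.le, ENNReal.ofReal_one]
    exact tsub_le_iff_left.2 (tsub_le_iff_right.1 h2)
  · obtain ⟨W, hW, huniq, hbound⟩ := LSTDRP.exists_unique_projected_bellman M π hμ hl.1 hl.2
      (LSTDRP.featSpace (LSTDRP.projFeat (Matrix.of H) φ))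
    refine ⟨W, hW, huniq, ?_⟩
    -- The competitor in the projected space: the function with coefficients `H α`.
    set g := LSTDRP.linComb (LSTDRP.projFeat (Matrix.of H) φ)
      (Matrix.toEuclideanLin (Matrix.of H) α) with hg
    have hfg : LSTDRP.wNorm μ (f - g) ≤ ε * m := by
      refine le_trans (le_of_eq ?_) hH
      rw [LSTDRP.wNorm]
      congr 1
      refine Finset.sum_congr rfl fun x _ => ?_
      have h1 : g x = ∑ i, (α.ofLp ⬝ᵥ H i) * ((φ x).ofLp ⬝ᵥ H i) := by
        change ∑ i, LSTDRP.projFeat (Matrix.of H) φ x i *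
          Matrix.toEuclideanLin (Matrix.of H) α i = _
        refine Finset.sum_congr rfl fun i _ => ?_
        rw [dotProduct_comm α.ofLp, dotProduct_comm (φ x).ofLp, mul_comm]
        rfl
      have h2 : f x = α.ofLp ⬝ᵥ (φ x).ofLp := by
        rw [← hαf, dotProduct_comm]; rfl
      rw [LSTDRP.projErr, Pi.sub_apply, h1, h2]
      ring
    have h3 := hbound g (LinearMap.mem_range_self _ _)
    refine h3.trans (mul_le_mul_of_nonneg_left ?_ (div_nonneg hlg (by linarith)))
    have h4 := LSTDRP.wNorm_add_le μ (M.value π - f) (f - g)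
    rw [sub_add_sub_cancel] at h4
    -- The factor `1 + 2 √Υ / √n` is at least one.
    have h5 : 0 ≤ 2 * √(LSTDRP.Upsilon β₀ β₁ κ n (δ / 2)) / √n := by positivity
    have h6 : ε * m ≤ ε * (1 + 2 * √(LSTDRP.Upsilon β₀ β₁ κ n (δ / 2)) / √n) * m :=
      mul_le_mul_of_nonneg_right (le_mul_of_one_le_right hε0 (by linarith)) hm0
    linarith
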